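/- Let $E$ be a real locally convex Hausdorff topological vector space with continuous dual $E'$. Then the following are equivalent. 1. $E$ has the metric convex compactness property: for every compact metrizable subset $K\subset E$ the closed convex hull of $K$ is compact. 2. Every continuous curve $f:[0,1]\to E$ is Pettis integrable with respect to Lebesgue measure, that is, the Pettis integral $\int_0^1 f(t)\,dt$ exists in $E$: there is $x\in E$ such that for every $e'\in E'$ the function $t\mapsto\langle e',f(t)\rangle$ is Lebesgue integrable on $[0,1]$ and $$\langle e',x\rangle=\int_0^1\langle e',f(t)\rangle\,dt .$$ -/

import Mathlib

open MeasureTheory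

/-- A topological vector space has the metric convex compactness property if the closed convex hull
of each of its compact metrizable subsets is compact. -/
def MetricConvexCompactness (E : Type*) [AddCommGroup E] [Module ℝ E] [TopologicalSpace E] : Prop :=
  ∀ K : Set E, IsCompact K → TopologicalSpace.MetrizableSpace K →
    IsCompact (closure (convexHull ℝ K))

/-- `x` is the Pettis integral of `f` with respect to `μ`: every continuous linear functional
composed with `f` is integrable, and its integral is the value of the functional at `x`. -/
def HasPettisIntegral {X E : Type*} [MeasurableSpace X] [AddCommGroup E] [Module ℝ E]
    [TopologicalSpace E] (f : X → E) (μ : Measure X) (x : E) : Prop :=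
  ∀ φ : E →L[ℝ] ℝ, Integrable (fun t => φ (f t)) μ ∧ ∫ t, φ (f t) ∂μ = φ x

/-- `f` is Pettis integrable with respect to `μ`: its Pettis integral exists in `E`. -/
def PettisIntegrable {X E : Type*} [MeasurableSpace X] [AddCommGroup E] [Module ℝ E]
    [TopologicalSpace E] (f : X → E) (μ : Measure X) : Prop :=
  ∃ x : E, HasPettisIntegral f μ x

/-!
If the closed convex hull of compact metrizable sets is compact, let `f` be a curve. Its range is
compact and metrizable, so the closed convex hull `C` of the range is compact. For finitely many
functionals at a time, a point of `C` takes the values the integral must take, because integrals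
stay in closed convex subsets of `ℝⁿ`; compactness of `C` gives one point for all functionals
(`pettisIntegrable_of_isCompact_closure_convexHull`).

Conversely, suppose that every curve is Pettis integrable, and let `K` be compact, metrizable and
nonempty. A continuous surjection from the Cantor set onto `K`, extended across the gaps by
Dugundji's theorem, is a curve `f` whose range contains `K`
(`IsCompact.exists_continuous_subset_range`). This `f` has a Pettis integral against every
probability measure `ν` on `[0,1]`: the average of `ν` and Lebesgue measure has a strictly
increasing distribution function, hence is the image of Lebesgue measure under a continuous
map `q` of `[0,1]`, so integrating `f ∘ q` and `f` for Lebesgue measure gives the integral of `f`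
for `ν` (`pettisIntegrable_of_forall_volume`). The set of all these integrals is convex, contains
`K`, and is compact (`isCompact_setOf_hasPettisIntegral`): the probability measures on `[0,1]` form
a compact space, which gives weak limits, and in a totally bounded set weak limits of ultrafilters
are limits. The closed convex hull of `K` is a closed subset of it.
-/

open Set Filter Topology

/-! ### Metrizability of continuous images -/

/-- The continuous image of `[0,1]` (or any compact second-countable space) in a Hausdorff space is
metrizable: precomposition embeds the continuous functions on the image into a separable space. -/
theorem metrizableSpace_of_continuous_surjective {X Y : Type*} [TopologicalSpace X] [CompactSpace X]
    [T2Space X] [SecondCountableTopology X] [TopologicalSpace Y] [T2Space Y] {f : X → Y}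
    (hf : Continuous f) (hs : Function.Surjective f) : TopologicalSpace.MetrizableSpace Y := by
  have : CompactSpace Y := hs.compactSpace hf
  let Q : Set C(X, ℝ) := range fun g : C(Y, ℝ) => g.comp ⟨f, hf⟩
  have : Nonempty Q := ⟨⟨_, 0, rfl⟩⟩
  obtain ⟨u, hu⟩ := TopologicalSpace.exists_dense_seq Q
  choose g hg using fun n => (u n).2
  refine Metric.PiNatEmbed.TopologicalSpace.MetrizableSpace.of_countable_separating
    (fun n => g n) (fun n => (g n).continuous) fun x y hxy => ?_
  obtain ⟨h, hx, hy, -⟩ := exists_continuous_zero_one_of_isClosed (isClosed_singleton (x := x))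
    (isClosed_singleton (x := y)) (disjoint_singleton.2 hxy)
  obtain ⟨a, rfl⟩ := hs x
  obtain ⟨b, rfl⟩ := hs y
  have hopen : IsOpen {q : Q | (q : C(X, ℝ)) a ≠ (q : C(X, ℝ)) b} :=
    isOpen_ne_fun ((continuous_eval_const a).comp continuous_subtype_val)
      ((continuous_eval_const b).comp continuous_subtype_val)
  obtain ⟨n, hn⟩ := hu.exists_mem_open hopen ⟨⟨_, h, rfl⟩, by
    have h0 := hx (mem_singleton (f a))
    have h1 := hy (mem_singleton (f b))
    simp_all⟩
  refine ⟨n, ?_⟩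
  rw [mem_ofPred_eq, ← hg n] at hn
  exact hn

/-! ### Pettis integrals -/

theorem Continuous.integrable_of_compactSpace {X F : Type*} [TopologicalSpace X] [CompactSpace X]
    [MeasurableSpace X] [OpensMeasurableSpace X] [NormedAddCommGroup F] {μ : Measure X}
    [IsFiniteMeasure μ] {f : X → F} (hf : Continuous f) : Integrable f μ :=
  hf.integrable_of_hasCompactSupport (HasCompactSupport.of_compactSpace f)

section Pettis

variable {X E : Type*} [MeasurableSpace X] [AddCommGroup E] [Module ℝ E]
  [TopologicalSpace E]

theorem HasPettisIntegral.add_measure {f : X → E} {μ ν : Measure X} {x y : E}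
    (hx : HasPettisIntegral f μ x) (hy : HasPettisIntegral f ν y) :
    HasPettisIntegral f (μ + ν) (x + y) := fun φ =>
  ⟨(hx φ).1.add_measure (hy φ).1, by
    rw [integral_add_measure (hx φ).1 (hy φ).1, (hx φ).2, (hy φ).2, map_add]⟩

theorem HasPettisIntegral.smul_measure {f : X → E} {μ : Measure X} {x : E}
    (hx : HasPettisIntegral f μ x) (c : NNReal) : HasPettisIntegral f (c • μ) ((c : ℝ) • x) :=
  fun φ => ⟨(hx φ).1.smul_measure_nnreal, by
    rw [integral_smul_nnreal_measure, (hx φ).2, map_smul]; rfl⟩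

theorem convex_setOf_hasPettisIntegral (f : X → E) :
    Convex ℝ {x | ∃ ν : ProbabilityMeasure X, HasPettisIntegral f (ν : Measure X) x} := by
  rintro x ⟨μ, hx⟩ y ⟨ν, hy⟩ a b ha hb hab
  lift a to NNReal using ha
  lift b to NNReal using hb
  refine ⟨⟨a • (μ : Measure X) + b • (ν : Measure X), ⟨?_⟩⟩,
    (hx.smul_measure a).add_measure (hy.smul_measure b)⟩
  simp only [Measure.add_apply, Measure.smul_apply, measure_univ, ENNReal.smul_def, smul_eq_mul,
    mul_one]
  exact_mod_cast hab

/-- If the closed convex hull of the range of `f` is compact, it contains the Pettis integral: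
finitely many of the equations `φ x = ∫ φ ∘ f` have a common solution in the hull by convexity in
finite dimensions, so all of them have one by compactness. -/
theorem pettisIntegrable_of_isCompact_closure_convexHull [TopologicalSpace X] [CompactSpace X]
    [OpensMeasurableSpace X] [IsTopologicalAddGroup E] [ContinuousSMul ℝ E] {μ : Measure X}
    [IsProbabilityMeasure μ] {f : X → E} (hf : Continuous f)
    (hC : IsCompact (closure (convexHull ℝ (range f)))) : PettisIntegrable f μ := by
  have hint (φ : E →L[ℝ] ℝ) : Integrable (fun t => φ (f t)) μ :=
    (φ.continuous.comp hf).integrable_of_compactSpace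
  obtain ⟨x, -, hx⟩ := hC.inter_iInter_nonempty
    (fun φ : E →L[ℝ] ℝ => {x | ∫ t, φ (f t) ∂μ = φ x})
    (fun φ => isClosed_eq continuous_const φ.continuous) fun u => by
      let L : E →L[ℝ] (u → ℝ) := ContinuousLinearMap.pi fun φ => φ.1
      have hLi : Integrable (fun t => L (f t)) μ := (L.continuous.comp hf).integrable_of_compactSpace
      obtain ⟨x, hxC, hx⟩ := ((convex_convexHull ℝ (range f)).closure.is_linear_image
        L.toLinearMap.isLinear).integral_mem (μ := μ) (hC.image L.continuous).isClosed
        (.of_forall fun t => ⟨f t, subset_closure (subset_convexHull ℝ _ ⟨t, rfl⟩), rfl⟩) hLi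
      refine ⟨x, hxC, mem_iInter₂.2 fun φ hφ => ?_⟩
      exact ((ContinuousLinearMap.proj (R := ℝ) (φ := fun _ : u => ℝ) ⟨φ, hφ⟩).integral_comp_comm
        hLi).trans (congrFun hx ⟨φ, hφ⟩).symm
  exact ⟨x, fun φ => ⟨hint φ, mem_iInter.1 hx φ⟩⟩

end Pettis

/-! ### Reparametrization of curves -/

/-- A strictly increasing distribution function on `[0,1]`, even one with jumps, has a continuous
generalized inverse, which transports Lebesgue measure to the given measure. -/
theorem exists_continuous_map_volume_eq (μ : Measure unitInterval) [IsProbabilityMeasure μ]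
    (hμ : StrictMono fun x => μ.real (Iic x)) :
    ∃ q : unitInterval → unitInterval, Continuous q ∧ (volume : Measure unitInterval).map q = μ := by
  let F : unitInterval → unitInterval := fun x => ⟨μ.real (Iic x), measureReal_nonneg,
    measureReal_le_one⟩
  have hF : StrictMono F := fun x y h => hμ h
  have hF1 : F 1 = 1 := Subtype.ext (by
    change μ.real (Iic 1) = 1
    rw [show (Iic 1 : Set unitInterval) = univ from eq_univ_of_forall fun x => x.2.2]
    simp)
  let q : unitInterval → unitInterval := fun t => sInf {x | t ≤ F x}
  have hFq (t : unitInterval) : t ≤ F (q t) := by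
    -- The distribution function is right-continuous, so the infimum defining `q t` is attained.
    rcases eq_or_lt_of_le (unitInterval.le_one' : q t ≤ 1) with h1 | h1
    · rw [h1, hF1]; exact unitInterval.le_one'
    have : IsProbabilityMeasure (μ.map ((↑) : unitInterval → ℝ)) :=
      Measure.isProbabilityMeasure_map (by fun_prop)
    have hG (x : unitInterval) : ProbabilityTheory.cdf (μ.map ((↑) : unitInterval → ℝ)) x = F x := by
      rw [ProbabilityTheory.cdf_eq_real,
        map_measureReal_apply measurable_subtype_coe measurableSet_Iic]
      rfl
    have hlim := ((ProbabilityTheory.cdf (μ.map ((↑) : unitInterval → ℝ))).right_continuous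
      (q t)).mono_left (nhdsWithin_mono _ Ioi_subset_Ici_self)
    rw [hG] at hlim
    refine Subtype.coe_le_coe.1 (ge_of_tendsto hlim ?_)
    filter_upwards [Ioo_mem_nhdsGT (show (q t : ℝ) < 1 from h1)] with x hx
    obtain ⟨y, hy, hyx⟩ := sInf_lt_iff.1
      (show q t < (⟨x, (q t).2.1.trans hx.1.le, hx.2.le⟩ : unitInterval) from hx.1)
    rw [hG ⟨x, (q t).2.1.trans hx.1.le, hx.2.le⟩]
    exact hy.trans (hF.monotone hyx.le)
  have gc : GaloisConnection q F := fun t x =>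
    ⟨fun h => (hFq t).trans (hF.monotone h), fun h => sInf_le h⟩
  have hqc : Continuous q := gc.monotone_l.continuous_of_surjective fun x =>
    ⟨F x, le_antisymm (gc.l_u_le x) (hF.le_iff_le.1 (hFq (F x)))⟩
  refine ⟨q, hqc, ?_⟩
  have : IsProbabilityMeasure ((volume : Measure unitInterval).map q) :=
    Measure.isProbabilityMeasure_map hqc.aemeasurable
  refine Measure.ext_of_Iic _ _ fun x => ?_
  rw [Measure.map_apply hqc.measurable measurableSet_Iic,
    show q ⁻¹' Iic x = Iic (F x) from Set.ext fun t => gc t x, unitInterval.volume_Iic]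
  exact ofReal_measureReal

/-! ### Curves through compact metrizable sets -/

/-- Dugundji's extension theorem: off `A`, the extension takes values in the convex hull of the
values of `g` at nearly closest points of `A`. -/
theorem IsClosed.exists_continuous_extension {X E : Type*} [MetricSpace X] [AddCommGroup E]
    [Module ℝ E] [TopologicalSpace E] [IsTopologicalAddGroup E] [ContinuousSMul ℝ E]
    [LocallyConvexSpace ℝ E] {A : Set X} (hA : IsClosed A) (hne : A.Nonempty) {g : A → E}
    (hg : Continuous g) : ∃ F : X → E, Continuous F ∧ ∀ a : A, F a = g a := by
  classical
  let T : (Aᶜ : Set X) → Set E := fun x =>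
    convexHull ℝ (g '' {a | dist (a : X) x < 2 * Metric.infDist (x : X) A})
  obtain ⟨f, hf⟩ := exists_continuous_forall_mem_convex_of_local_const (t := T)
    (fun x => convex_convexHull ℝ _) fun x => by
      have hx : 0 < Metric.infDist (x : X) A := (hA.notMem_iff_infDist_pos hne).1 x.2
      obtain ⟨a, ha, hax⟩ := (Metric.infDist_lt_iff hne).1
        (show Metric.infDist (x : X) A < 2 * Metric.infDist (x : X) A by linarith)
      refine ⟨g ⟨a, ha⟩, ?_⟩
      have hopen : IsOpen {y : (Aᶜ : Set X) | dist a y < 2 * Metric.infDist (y : X) A} :=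
        isOpen_lt (by fun_prop)
          (((Metric.continuous_infDist_pt A).comp continuous_subtype_val).const_mul 2)
      filter_upwards [hopen.mem_nhds (by rwa [mem_ofPred_eq, dist_comm])] with y hy
      exact subset_convexHull ℝ _ ⟨⟨a, ha⟩, hy, rfl⟩
  let F : X → E := fun x => if h : x ∈ A then g ⟨x, h⟩ else f ⟨x, h⟩
  have hFA (a : A) : F a = g a := dif_pos a.2
  have hFf (x : (Aᶜ : Set X)) : F x = f x := dif_neg x.2
  refine ⟨F, continuous_iff_continuousAt.2 fun c => ?_, hFA⟩
  by_cases hc : c ∈ A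
  · refine ((LocallyConvexSpace.convex_basis (𝕜 := ℝ) (F c)).tendsto_right_iff).2 fun U hU => ?_
    have hgU : g ⁻¹' U ∈ 𝓝 (⟨c, hc⟩ : A) := hg.continuousAt (hFA ⟨c, hc⟩ ▸ hU.1)
    obtain ⟨δ, hδ, hball⟩ := Metric.mem_nhds_iff.1 hgU
    filter_upwards [Metric.ball_mem_nhds c (show 0 < δ / 3 by positivity)] with x hx
    rw [Metric.mem_ball] at hx
    by_cases hxA : x ∈ A
    · rw [hFA ⟨x, hxA⟩]
      exact hball (show dist x c < δ by linarith)
    · rw [hFf ⟨x, hxA⟩]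
      refine convexHull_min ?_ hU.2 (hf ⟨x, hxA⟩)
      rintro _ ⟨a, ha, rfl⟩
      have h1 : Metric.infDist x A ≤ dist x c := Metric.infDist_le_dist_of_mem hc
      have h2 : dist (a : X) c ≤ dist (a : X) x + dist x c := dist_triangle _ _ _
      have h3 : dist (a : X) x < 2 * Metric.infDist x A := ha
      exact hball (show dist (a : X) c < δ by linarith)
  · refine (hA.isOpen_compl.isOpenEmbedding_subtypeVal.continuousAt_iff (x := ⟨c, hc⟩)).1 ?_
    rw [show F ∘ Subtype.val = f from funext hFf]
    exact f.continuous.continuousAt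

section LocallyConvex

variable {E : Type*} [AddCommGroup E] [Module ℝ E] [TopologicalSpace E]
  [IsTopologicalAddGroup E] [ContinuousSMul ℝ E] [LocallyConvexSpace ℝ E]

/-- A nonempty compact metrizable set is covered by a curve: extend a continuous surjection from the
Cantor set across the gaps. -/
theorem IsCompact.exists_continuous_subset_range {K : Set E} (hK : IsCompact K)
    [TopologicalSpace.MetrizableSpace K] (hne : K.Nonempty) :
    ∃ f : unitInterval → E, Continuous f ∧ K ⊆ range f := by
  let := TopologicalSpace.metrizableSpaceMetric K
  have := isCompact_iff_compactSpace.1 hK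
  have := hne.to_subtype
  obtain ⟨p, hp, hps⟩ := exists_nat_bool_continuous_surjective_of_compact K
  obtain ⟨F, hF, hFg⟩ := isClosed_cantorSet.exists_continuous_extension ⟨0, zero_mem_cantorSet⟩
    (g := fun a => (p (cantorSetHomeomorphNatToBool a) : E))
    (continuous_subtype_val.comp (hp.comp cantorSetHomeomorphNatToBool.continuous))
  refine ⟨fun t => F t, hF.comp continuous_subtype_val, fun k hk => ?_⟩
  obtain ⟨b, hb⟩ := hps ⟨k, hk⟩
  obtain ⟨a, rfl⟩ := cantorSetHomeomorphNatToBool.surjective b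
  exact ⟨⟨a, cantorSet_subset_unitInterval a.2⟩, by simp only [hFg, hb]⟩

/-! ### Compactness of the set of Pettis integrals -/

/-- A Cauchy filter converges to each of its weak limits, because the topology has a basis of
neighborhoods of `0` that are weakly closed. -/
theorem Cauchy.le_nhds_of_tendsto_dual {E : Type*} [AddCommGroup E] [Module ℝ E] [UniformSpace E]
    [IsUniformAddGroup E] [ContinuousSMul ℝ E] [LocallyConvexSpace ℝ E] {l : Filter E}
    (hl : Cauchy l) {x : E} (hx : ∀ φ : E →L[ℝ] ℝ, Tendsto φ l (𝓝 (φ x))) : l ≤ 𝓝 x := by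
  have := hl.1
  intro V hV
  have hV0 : (fun y => y + x) ⁻¹' V ∈ 𝓝 (0 : E) :=
    (continuous_add_const x).continuousAt (by simpa using hV)
  obtain ⟨U, ⟨hU, hUcl, hUc⟩, hUV⟩ := (nhds_hasBasis_absConvex_closed ℝ E).mem_iff.1 hV0
  have hUu : {p : E × E | p.2 - p.1 ∈ U} ∈ uniformity E := by
    rw [uniformity_eq_comap_nhds_zero]
    exact preimage_mem_comap hU
  obtain ⟨S, hS, hSU⟩ := (cauchy_iff.1 hl).2 _ hUu
  filter_upwards [hS] with s hs
  suffices h : s - x ∈ U by simpa using hUV h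
  by_contra h
  obtain ⟨φ, u, hφ, hu⟩ := geometric_hahn_banach_closed_point hUc.2 hUcl h
  have hlim : Tendsto (fun y => φ (s - y)) l (𝓝 (φ (s - x))) := by
    simpa only [map_sub] using (hx φ).const_sub (φ s)
  refine hu.not_ge (le_of_tendsto hlim ?_)
  filter_upwards [hS] with y hy
  exact (hφ _ (hSU (mk_mem_prod hy hs))).le

/-- Every Pettis integral against a probability measure lies in the closed convex hull of the range,
by separation. -/
theorem HasPettisIntegral.mem_closure_convexHull {X : Type*} [MeasurableSpace X] {f : X → E}
    {μ : Measure X} [IsProbabilityMeasure μ] {x : E} (hx : HasPettisIntegral f μ x) :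
    x ∈ closure (convexHull ℝ (range f)) := by
  by_contra h
  obtain ⟨φ, u, hφ, hu⟩ :=
    geometric_hahn_banach_closed_point (convex_convexHull ℝ (range f)).closure isClosed_closure h
  have hle : ∫ t, φ (f t) ∂μ ≤ ∫ _, u ∂μ :=
    integral_mono (hx φ).1 (integrable_const u)
      fun t => (hφ _ (subset_closure (subset_convexHull ℝ _ ⟨t, rfl⟩))).le
  rw [(hx φ).2, integral_const, probReal_univ, one_smul] at hle
  exact hu.not_ge hle

/-- If every curve is Pettis integrable for Lebesgue measure, then for every probability measure on
`[0,1]`. -/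
theorem pettisIntegrable_of_forall_volume {E : Type*} [AddCommGroup E] [Module ℝ E]
    [TopologicalSpace E]
    (h : ∀ f : unitInterval → E, Continuous f → PettisIntegrable f (volume : Measure unitInterval))
    {f : unitInterval → E} (hf : Continuous f) (ν : Measure unitInterval) [IsProbabilityMeasure ν] :
    PettisIntegrable f ν := by
  -- The average of `ν` and Lebesgue measure has a strictly increasing distribution function.
  let μ : Measure unitInterval := (1 / 2 : NNReal) • (ν + volume)
  have : IsProbabilityMeasure μ := ⟨by
    simp only [μ, Measure.smul_apply, Measure.add_apply, measure_univ]
    rw [ENNReal.smul_def, smul_eq_mul, one_add_one_eq_two, one_div, ENNReal.coe_inv two_ne_zero]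
    exact ENNReal.inv_mul_cancel two_ne_zero ENNReal.ofNat_ne_top⟩
  have hμ : StrictMono fun x => μ.real (Iic x) := fun x y hxy => by
    have hν : ν.real (Iic x) ≤ ν.real (Iic y) := measureReal_mono (Iic_subset_Iic.2 hxy.le)
    have hv (z : unitInterval) : (volume : Measure unitInterval).real (Iic z) = z := by
      rw [measureReal_def, unitInterval.volume_Iic, ENNReal.toReal_ofReal z.2.1]
    have hxy' : (x : ℝ) < y := hxy
    simp only [μ, measureReal_nnreal_smul_apply]
    rw [measureReal_add_apply, measureReal_add_apply, hv, hv]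
    have : (0 : ℝ) < ((1 / 2 : NNReal) : ℝ) := by norm_num
    gcongr ?_ * ?_
    linarith
  obtain ⟨q, hq, hqμ⟩ := exists_continuous_map_volume_eq μ hμ
  obtain ⟨x, hx⟩ := h (f ∘ q) (hf.comp hq)
  obtain ⟨y, hy⟩ := h f hf
  have hsum : ν + volume = (2 : NNReal) • μ := by
    rw [smul_smul, show (2 : NNReal) * (1 / 2) = 1 by norm_num, one_smul]
  have hμx : HasPettisIntegral f μ x := fun φ => by
    have hφ : Continuous fun t => φ (f t) := φ.continuous.comp hf
    refine ⟨hφ.integrable_of_compactSpace, ?_⟩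
    rw [← hqμ, integral_map hq.aemeasurable hφ.aestronglyMeasurable]
    exact (hx φ).2
  refine ⟨(2 : ℝ) • x - y, fun φ => ?_⟩
  have hφν : Integrable (fun t => φ (f t)) ν := (φ.continuous.comp hf).integrable_of_compactSpace
  have h2 := (hμx.smul_measure 2 φ).2
  rw [← hsum, integral_add_measure hφν (hy φ).1, (hy φ).2] at h2
  exact ⟨hφν, by rw [map_sub]; exact eq_sub_of_add_eq h2⟩

/-- The Pettis integrals of a curve against all probability measures form a compact set. The map
sending a measure to its integral is continuous for the weak topologies, and weak convergence
upgrades to convergence because the closed convex hull of the curve is totally bounded. -/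
theorem isCompact_setOf_hasPettisIntegral {X : Type*} [TopologicalSpace X] [CompactSpace X]
    [T2Space X] [MeasurableSpace X] [BorelSpace X] {f : X → E} (hf : Continuous f)
    (h : ∀ ν : ProbabilityMeasure X, PettisIntegrable f (ν : Measure X)) :
    IsCompact {x | ∃ ν : ProbabilityMeasure X, HasPettisIntegral f (ν : Measure X) x} := by
  let := IsTopologicalAddGroup.rightUniformSpace E
  have : IsUniformAddGroup E := isUniformAddGroup_of_addCommGroup
  have htb : TotallyBounded
      {x | ∃ ν : ProbabilityMeasure X, HasPettisIntegral f (ν : Measure X) x} :=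
    (isCompact_range hf).totallyBounded.convexHull.closure.subset fun x ⟨ν, hx⟩ =>
      hx.mem_closure_convexHull
  refine isCompact_iff_ultrafilter_le_nhds.2 fun l hl => ?_
  have hlC := le_principal_iff.1 hl
  obtain ⟨x₀, ν₀, -⟩ := l.nonempty_of_mem hlC
  have : Nonempty (ProbabilityMeasure X) := ⟨ν₀⟩
  choose! ν hν using fun x (hx : x ∈ {x | ∃ ν : ProbabilityMeasure X,
    HasPettisIntegral f (ν : Measure X) x}) => hx
  obtain ⟨ν', -, hlim⟩ := isCompact_iff_ultrafilter_le_nhds.1 (isCompact_univ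
    (X := ProbabilityMeasure X)) (l.map ν) (by simp)
  obtain ⟨x, hx⟩ := h ν'
  refine ⟨x, ⟨ν', hx⟩, (totallyBounded_iff_ultrafilter.1 htb l hl).le_nhds_of_tendsto_dual
    fun φ => ?_⟩
  have hφ := ProbabilityMeasure.tendsto_iff_forall_integral_tendsto.1
    (show Tendsto ν l (𝓝 ν') from hlim)
    (BoundedContinuousFunction.mkOfCompact ⟨fun t => φ (f t), φ.continuous.comp hf⟩)
  simp only [BoundedContinuousFunction.mkOfCompact_apply, ContinuousMap.coe_mk] at hφ
  rw [(hx φ).2] at hφ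
  refine hφ.congr' ?_
  filter_upwards [hlC] with y hy
  exact (hν y hy φ).2

end LocallyConvex

/-! ### Metric convex compactness and Pettis integrability -/

theorem theorem1 (E : Type*) [AddCommGroup E] [Module ℝ E] [TopologicalSpace E]
    [IsTopologicalAddGroup E] [ContinuousSMul ℝ E] [LocallyConvexSpace ℝ E] [T2Space E] :
    MetricConvexCompactness E ↔
      ∀ f : unitInterval → E, Continuous f → PettisIntegrable f (volume : Measure unitInterval) := by
  refine ⟨fun h f hf => pettisIntegrable_of_isCompact_closure_convexHull hf
    (h _ (isCompact_range hf) (metrizableSpace_of_continuous_surjective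
      (hf.subtype_mk _) rangeFactorization_surjective)), fun h K hK hKm => ?_⟩
  rcases K.eq_empty_or_nonempty with rfl | hne
  · simp
  obtain ⟨f, hf, hKf⟩ := hK.exists_continuous_subset_range hne
  have hC := isCompact_setOf_hasPettisIntegral hf fun ν =>
    pettisIntegrable_of_forall_volume h hf (ν : Measure unitInterval)
  refine hC.of_isClosed_subset isClosed_closure (closure_minimal (convexHull_min (fun k hk => ?_)
    (convex_setOf_hasPettisIntegral f)) hC.isClosed)
  obtain ⟨t, rfl⟩ := hKf hk
  refine ⟨⟨Measure.dirac t, inferInstance⟩, fun φ => ?_⟩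
  rw [ProbabilityMeasure.coe_mk]
  exact ⟨(φ.continuous.comp hf).integrable_of_compactSpace, integral_dirac _ _⟩
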